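/- Let $n\ge 1$ and let $$P=\begin{bmatrix}\theta_0&\lambda_0\\ \mu_1&\theta_1&\lambda_1\\ &\ddots&\ddots&\ddots\\ &&\mu_{n-2}&\theta_{n-2}&\lambda_{n-2}\\ &&&\mu_{n-1}&\theta_{n-1}\end{bmatrix}\in\mathbb R^{n\times n}$$ be a tridiagonal matrix (rows and columns numbered $0,\dots,n-1$) that is stochastic (nonnegative entries, row sums $1$) and irreducible. Let $\mathbf 1$ be the all-ones vector. For every $v\in\mathbb R^n$ with $v^\top\mathbf 1=1$ the matrix $I-P+\mathbf 1v^\top$ is invertible, and Kemeny's constant of $P$ is $$\kappa(P)=\operatorname{trace}\bigl((I-P+\mathbf 1v^\top)^{-1}\bigr)-1,$$ whose value does not depend on the choice of $v$. With empty products equal to $1$, put $$t(k)=\prod_{\ell=0}^{k-1}\lambda_\ell\prod_{\ell=k+1}^{n-1}\mu_\ell\qquad(0\le k\le n-1),$$ $$w(j,k,p)=\prod_{\ell=0}^{j-1}\lambda_\ell\prod_{\ell=j+1}^{p}\mu_\ell\prod_{\ell=p+1}^{k-1}\lambda_\ell\prod_{\ell=k+1}^{n-1}\mu_\ell\qquad(0\le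 j\le p<k\le n-1).$$ Then $\sum_{k=0}^{n-1}t(k)>0$ and $$\kappa(P)=\frac{\sum_{0\le j<k\le n-1}\sum_{p=j}^{k-1}w(j,k,p)}{\sum_{k=0}^{n-1}t(k)}.$$ Moreover, there is a unique vector $\pi=(\pi_0,\dots,\pi_{n-1})$ with $\pi^\top P=\pi^\top$ and $\pi^\top\mathbf 1=1$; its entries are positive, and with $\sigma_k=\sum_{j=0}^k\pi_j$, $$\kappa(P)=\sum_{k=0}^{n-2}\frac{\sigma_k(1-\sigma_k)}{\lambda_k\pi_k}.$$ Explicitly, $$\pi_0=\Bigl(\sum_{j=0}^{n-1}\frac{\prod_{\ell=0}^{j-1}\lambda_\ell}{\prod_{\ell=1}^{j}\mu_\ell}\Bigr)^{-1},\qquad \pi_j=\pi_0\,\frac{\prod_{\ell=0}^{j-1}\lambda_\ell}{\prod_{\ell=1}^{j}\mu_\ell}\quad(j=1,\dots,n-1).$$ -/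

import Mathlib

open scoped Matrix

/-- The `n × n` tridiagonal matrix, with rows and columns numbered `0, …, n - 1`, whose row `i` has
diagonal entry `theta i`, superdiagonal entry `lam i` (at column `i + 1`) and subdiagonal entry
`mu i` (at column `i - 1`). Only `theta i` with `i < n`, `lam i` with `i + 1 < n` and `mu i` with
`1 ≤ i < n` are used. -/
def birthDeathMatrix (n : ℕ) (theta lam mu : ℕ → ℝ) : Matrix (Fin n) (Fin n) ℝ :=
  Matrix.of fun i j =>
    if (j : ℕ) = (i : ℕ) then theta i
    else if (j : ℕ) = (i : ℕ) + 1 then lam i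
    else if (i : ℕ) = (j : ℕ) + 1 then mu i
    else 0

/-- The matrix `I - P + 𝟏 vᵀ`. -/
def kemenyMatrix {n : ℕ} (P : Matrix (Fin n) (Fin n) ℝ) (v : Fin n → ℝ) :
    Matrix (Fin n) (Fin n) ℝ :=
  1 - P + Matrix.vecMulVec 1 v

/-- Kemeny's constant `κ(P) = trace ((I - P + 𝟏 vᵀ)⁻¹) - 1`, where `v` is any vector whose entries
sum to one; for an irreducible stochastic matrix `P` the value does not depend on `v`. -/
noncomputable def kemenyConstant {n : ℕ} (P : Matrix (Fin n) (Fin n) ℝ) (v : Fin n → ℝ) : ℝ :=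
  (kemenyMatrix P v)⁻¹.trace - 1

/-- `t(k)`, the product of `lam ℓ` for `0 ≤ ℓ ≤ k - 1` and of `mu ℓ` for `k + 1 ≤ ℓ ≤ n - 1`. -/
noncomputable def treeWeight (n : ℕ) (lam mu : ℕ → ℝ) (k : ℕ) : ℝ :=
  (∏ l ∈ Finset.Ico 0 k, lam l) * ∏ l ∈ Finset.Ico (k + 1) n, mu l

/-- `w(j,k,p)`, the product of `lam ℓ` for `0 ≤ ℓ ≤ j - 1`, of `mu ℓ` for `j + 1 ≤ ℓ ≤ p`, of
`lam ℓ` for `p + 1 ≤ ℓ ≤ k - 1` and of `mu ℓ` for `k + 1 ≤ ℓ ≤ n - 1`. -/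
noncomputable def forestWeight (n : ℕ) (lam mu : ℕ → ℝ) (j k p : ℕ) : ℝ :=
  (∏ l ∈ Finset.Ico 0 j, lam l) * (∏ l ∈ Finset.Icc (j + 1) p, mu l) *
    (∏ l ∈ Finset.Ico (p + 1) k, lam l) * ∏ l ∈ Finset.Ico (k + 1) n, mu l

/-- `π` is a left fixed vector of `P` whose entries sum to one. -/
def IsStationaryVector {n : ℕ} (P : Matrix (Fin n) (Fin n) ℝ) (pi : Fin n → ℝ) : Prop :=
  pi ᵥ* P = pi ∧ ∑ i, pi i = 1

/-- The partial sum `σ_k = π_0 + ⋯ + π_k`. -/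
noncomputable def partialSum {n : ℕ} (pi : Fin n → ℝ) (k : Fin n) : ℝ :=
  ∑ j ∈ Finset.Iic k, pi j

/-- The ratio `(∏_{ℓ=0}^{j-1} lam ℓ) / (∏_{ℓ=1}^{j} mu ℓ)`. -/
noncomputable def rateRatio (lam mu : ℕ → ℝ) (j : ℕ) : ℝ :=
  (∏ l ∈ Finset.Ico 0 j, lam l) / ∏ l ∈ Finset.Icc 1 j, mu l

/-! If `(1 - P) * G = 1 - 𝟏qᵀ` with `G𝟏 = 0` and `q` of total mass one, then adding a suitable `𝟏uᵀ`
to `G` inverts `1 - P + 𝟏vᵀ`, and the trace grows by exactly one. Hence `κ = tr G` for every `v`,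
and the same identity forces every stationary vector to equal `q`. For a birth-death chain, detailed
balance is solved by `q = t / T`, with `T` the sum of the `t k`, and `G` is explicit
(`potentialKernel`). Its trace is the sum over `p < k` of `q k * σ p / (lam p * q p)`. Summing over
`k` first gives the formula in partial sums; expanding `σ p` and using `t j * t k = w(j,k,p) * lam p
* t p` gives the quotient formula. -/

namespace Matrix

/-- In an irreducible matrix some positive entry leads out of every proper nonempty index set. -/
theorem IsIrreducible.exists_pos_of_mem_of_notMem {m : Type*} {A : Matrix m m ℝ}
    (hA : A.IsIrreducible) {S : Set m} {i j : m} (hi : i ∈ S) (hj : j ∉ S) :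
    ∃ a ∈ S, ∃ b ∉ S, 0 < A a b := by
  let : Quiver m := A.toQuiver
  by_contra! h
  have key : ∀ b (_ : Quiver.Path i b), b ∈ S := by
    intro b p
    induction p with
    | nil => exact hi
    | @cons a b _ e ih =>
      by_contra hb
      exact absurd e.down (not_lt.2 (h a ih b hb))
  exact hj (key j (hA.connected i j).choose)

end Matrix

section Kemeny

variable {n : ℕ} {P G : Matrix (Fin n) (Fin n) ℝ} {q v : Fin n → ℝ}

/-- Since `(1 - P)𝟏 = 0`, the rank-one correction is invisible to `1 - P`; it is chosen so that the
factor `𝟏vᵀ` restores the missing `𝟏qᵀ`. -/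
theorem kemenyMatrix_mul_eq_one (hP : P *ᵥ 1 = 1)
    (hG : (1 - P) * G = 1 - Matrix.vecMulVec 1 q) (hv : ∑ i, v i = 1) :
    kemenyMatrix P v * (G + Matrix.vecMulVec 1 (q - v ᵥ* G)) = 1 := by
  have hP' : (1 - P) *ᵥ (1 : Fin n → ℝ) = 0 := by
    rw [Matrix.sub_mulVec, Matrix.one_mulVec, hP, sub_self]
  have hv' : v ⬝ᵥ (1 : Fin n → ℝ) = 1 := by simpa [dotProduct] using hv
  rw [kemenyMatrix, add_mul, mul_add, mul_add, hG, Matrix.mul_vecMulVec, hP',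
    Matrix.vecMulVec_mul, Matrix.vecMulVec_mul_vecMulVec, hv']
  ext i j
  simp

theorem isUnit_kemenyMatrix (hP : P *ᵥ 1 = 1)
    (hG : (1 - P) * G = 1 - Matrix.vecMulVec 1 q) (hv : ∑ i, v i = 1) :
    IsUnit (kemenyMatrix P v) :=
  IsUnit.of_mul_eq_one _ (kemenyMatrix_mul_eq_one hP hG hv)

/-- Kemeny's constant is the trace of any generalized inverse of `1 - P` with zero row sums. -/
theorem kemenyConstant_eq_trace (hP : P *ᵥ 1 = 1)
    (hG : (1 - P) * G = 1 - Matrix.vecMulVec 1 q) (hG1 : G *ᵥ 1 = 0) (hq : ∑ i, q i = 1)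
    (hv : ∑ i, v i = 1) : kemenyConstant P v = G.trace := by
  have h0 : (v ᵥ* G) ⬝ᵥ (1 : Fin n → ℝ) = 0 := by
    rw [← Matrix.dotProduct_mulVec, hG1, dotProduct_zero]
  have h1 : ∑ i, (v ᵥ* G) i = 0 := by simpa [dotProduct] using h0
  rw [kemenyConstant, Matrix.inv_eq_right_inv (kemenyMatrix_mul_eq_one hP hG hv),
    Matrix.trace_add]
  have h2 : (Matrix.vecMulVec (1 : Fin n → ℝ) (q - v ᵥ* G)).trace = 1 := by
    simp [Matrix.trace, Finset.sum_sub_distrib, hq, h1]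
  rw [h2, add_sub_cancel_right]

theorem IsStationaryVector.eq (hG : (1 - P) * G = 1 - Matrix.vecMulVec 1 q)
    {x : Fin n → ℝ} (hx : IsStationaryVector P x) : x = q := by
  have h0 : x ᵥ* ((1 - P) * G) = 0 := by
    rw [← Matrix.vecMul_vecMul, Matrix.vecMul_sub, Matrix.vecMul_one, hx.1, sub_self,
      Matrix.zero_vecMul]
  have h1 : x ⬝ᵥ (1 : Fin n → ℝ) = 1 := by simpa [dotProduct] using hx.2
  rw [hG, Matrix.vecMul_sub, Matrix.vecMul_one, Matrix.vecMul_vecMulVec, h1] at h0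
  simpa [sub_eq_zero] using h0

end Kemeny

section BirthDeath

variable {n : ℕ} {theta lam mu : ℕ → ℝ}

/-- Taking `f` on all of `ℕ` lets neighbours be written `i ± 1`; the guards discard values outside
the matrix. -/
theorem sum_birthDeathMatrix_mul (f : ℕ → ℝ) (i : Fin n) :
    ∑ j : Fin n, birthDeathMatrix n theta lam mu i j * f j =
      theta i * f i + (if (i : ℕ) + 1 < n then lam i * f (i + 1) else 0) +
        (if 1 ≤ (i : ℕ) then mu i * f (i - 1) else 0) := by
  obtain ⟨i, hi⟩ := i
  simp only [birthDeathMatrix, Matrix.of_apply]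
  rw [Fin.sum_univ_eq_sum_range (fun j => (if j = i then theta i else if j = i + 1 then lam i
    else if i = j + 1 then mu i else 0) * f j) n]
  have h : ∀ j, (if j = i then theta i else if j = i + 1 then lam i
      else if i = j + 1 then mu i else 0) * f j =
      (if j = i then theta i * f i else 0) + (if j = i + 1 then lam i * f (i + 1) else 0) +
        (if j = i - 1 then (if 1 ≤ i then mu i * f (i - 1) else 0) else 0) := by
    intro j
    rcases i with _ | i
    · grind
    · grind
  simp only [h, Finset.sum_add_distrib, Finset.sum_ite_eq', Finset.mem_range, hi, if_true]
  rw [if_pos (show i - 1 < n by omega)]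

theorem sum_one_sub_birthDeathMatrix_mul
    (hP : birthDeathMatrix n theta lam mu *ᵥ 1 = 1) (f : ℕ → ℝ) (i : Fin n) :
    ∑ j : Fin n, (1 - birthDeathMatrix n theta lam mu) i j * f j =
      (if (i : ℕ) + 1 < n then lam i * (f i - f (i + 1)) else 0) +
        (if 1 ≤ (i : ℕ) then mu i * (f i - f (i - 1)) else 0) := by
  have h1 := congrFun hP i
  simp only [Matrix.mulVec, dotProduct, Pi.one_apply] at h1
  have h2 := sum_birthDeathMatrix_mul (n := n) (theta := theta) (lam := lam) (mu := mu)
    (fun _ => (1 : ℝ)) i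
  rw [h1] at h2
  have h3 : ∑ j : Fin n, (1 - birthDeathMatrix n theta lam mu) i j * f j =
      f i - ∑ j : Fin n, birthDeathMatrix n theta lam mu i j * f j := by
    simp [sub_mul, Finset.sum_sub_distrib, Matrix.one_apply]
  rw [h3, sum_birthDeathMatrix_mul]
  split_ifs at h2 ⊢ <;> linear_combination f i * h2

theorem lam_pos_of_isIrreducible (h : (birthDeathMatrix n theta lam mu).IsIrreducible) {k : ℕ}
    (hk : k + 1 < n) : 0 < lam k := by
  -- The only possible edge out of the initial segment `{0, …, k}` is `k → k + 1`.
  obtain ⟨a, ha, b, hb, hab⟩ := h.exists_pos_of_mem_of_notMem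
    (S := {i | (i : ℕ) ≤ k}) (i := ⟨k, by omega⟩) (j := ⟨k + 1, hk⟩) (by simp) (by simp)
  simp only [Set.mem_ofPred_eq, not_le] at ha hb
  simp only [birthDeathMatrix, Matrix.of_apply] at hab
  split_ifs at hab with h1 h2 h3
  · omega
  · rwa [show k = a by omega]
  · omega
  · exact absurd hab (lt_irrefl _)

theorem mu_pos_of_isIrreducible (h : (birthDeathMatrix n theta lam mu).IsIrreducible) {k : ℕ}
    (hk0 : 1 ≤ k) (hk : k < n) : 0 < mu k := by
  obtain ⟨a, ha, b, hb, hab⟩ := h.exists_pos_of_mem_of_notMem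
    (S := {i | k ≤ (i : ℕ)}) (i := ⟨k, hk⟩) (j := ⟨k - 1, by omega⟩) (by simp)
    (by simp only [Set.mem_ofPred_eq]; omega)
  simp only [Set.mem_ofPred_eq, not_le] at ha hb
  simp only [birthDeathMatrix, Matrix.of_apply] at hab
  split_ifs at hab with h1 h2 h3
  · omega
  · omega
  · rwa [show k = a by omega]
  · exact absurd hab (lt_irrefl _)

/-- The generalized inverse of `1 - P`, with vanishing row `0`, for a birth-death chain `P` with
reversing probability vector `q`. -/
noncomputable def potentialKernel (lam q : ℕ → ℝ) (i j : ℕ) : ℝ :=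
  ∑ k ∈ Finset.range i,
    q j * ((∑ l ∈ Finset.range (k + 1), q l) - if j < k + 1 then 1 else 0) / (lam k * q k)

theorem potentialKernel_succ (lam q : ℕ → ℝ) (i j : ℕ) :
    potentialKernel lam q (i + 1) j = potentialKernel lam q i j +
      q j * ((∑ l ∈ Finset.range (i + 1), q l) - if j < i + 1 then 1 else 0) / (lam i * q i) :=
  Finset.sum_range_succ _ _

theorem sum_potentialKernel {q : ℕ → ℝ} (hq1 : ∑ l ∈ Finset.range n, q l = 1) {i : ℕ}
    (hi : i < n) : ∑ j ∈ Finset.range n, potentialKernel lam q i j = 0 := by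
  simp only [potentialKernel]
  rw [Finset.sum_comm]
  -- Each `k` contributes zero: both parts of the numerator sum over `j` to `σ k`.
  refine Finset.sum_eq_zero fun k hk => ?_
  rw [Finset.mem_range] at hk
  rw [← Finset.sum_div]
  simp only [mul_sub, Finset.sum_sub_distrib, ← Finset.sum_mul, hq1, one_mul, mul_ite, mul_one,
    mul_zero]
  rw [← Finset.sum_filter]
  have : (Finset.range n).filter (· < k + 1) = Finset.range (k + 1) := by
    ext x; simp only [Finset.mem_filter, Finset.mem_range]; omega
  rw [this, sub_self, zero_div]

theorem one_sub_birthDeathMatrix_mul_potentialKernel {q : ℕ → ℝ}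
    (hP : birthDeathMatrix n theta lam mu *ᵥ 1 = 1)
    (hlam : ∀ k, k + 1 < n → 0 < lam k) (hq : ∀ k, k < n → 0 < q k)
    (hq1 : ∑ l ∈ Finset.range n, q l = 1)
    (hrev : ∀ k, k + 1 < n → lam k * q k = mu (k + 1) * q (k + 1)) :
    (1 - birthDeathMatrix n theta lam mu) *
        Matrix.of (fun i j : Fin n => potentialKernel lam q i j) =
      1 - Matrix.vecMulVec 1 (fun j : Fin n => q j) := by
  ext i j
  rw [Matrix.mul_apply]
  simp only [Matrix.of_apply]
  rw [sum_one_sub_birthDeathMatrix_mul hP (fun i => potentialKernel lam q i j) i]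
  simp only [Matrix.sub_apply, Matrix.vecMulVec_apply, Pi.one_apply, one_mul, Matrix.one_apply]
  obtain ⟨i, hi⟩ := i
  obtain ⟨j, hj⟩ := j
  simp only [Fin.mk.injEq]
  have hqi := (hq i hi).ne'
  -- Both `s 0` and `s n` vanish, so the two boundary rows obey the same formula as interior ones.
  set s : ℕ → ℝ := fun m => (∑ l ∈ Finset.range m, q l) - if j < m then 1 else 0 with hs
  have up : (if i + 1 < n then
      lam i * (potentialKernel lam q i j - potentialKernel lam q (i + 1) j) else 0) =
      -(q j * s (i + 1) / q i) := by
    split_ifs with h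
    · have := (hlam i h).ne'
      rw [potentialKernel_succ]
      simp only [hs]
      field_simp
      ring
    · have : i + 1 = n := by omega
      simp [hs, this, hq1, hj]
  have down : (if 1 ≤ i then
      mu i * (potentialKernel lam q i j - potentialKernel lam q (i - 1) j) else 0) =
      q j * s i / q i := by
    split_ifs with h
    · obtain ⟨m, rfl⟩ := Nat.exists_eq_add_of_le' h
      rw [Nat.add_sub_cancel, potentialKernel_succ, hrev m hi]
      have : mu (m + 1) ≠ 0 := fun h0 => by
        have h3 := hrev m hi
        rw [h0, zero_mul] at h3
        exact (mul_pos (hlam m hi) (hq m (by omega))).ne' h3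
      simp only [hs]
      field_simp
      ring
    · have : i = 0 := by omega
      simp [hs, this]
  rw [up, down]
  have hstep : s (i + 1) = s i + q i - if i = j then 1 else 0 := by
    simp only [hs, Finset.sum_range_succ]
    split_ifs <;> first | omega | ring
  rw [hstep]
  split_ifs with h
  · subst h
    field_simp
    ring
  · field_simp
    ring

/-- Detailed balance makes `q i * P i j` symmetric, so column sums reduce to row sums. -/
theorem vecMul_birthDeathMatrix_of_reversible {q : ℕ → ℝ}
    (hP : birthDeathMatrix n theta lam mu *ᵥ 1 = 1)
    (hrev : ∀ k, k + 1 < n → lam k * q k = mu (k + 1) * q (k + 1)) :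
    (fun j : Fin n => q j) ᵥ* birthDeathMatrix n theta lam mu = fun j : Fin n => q j := by
  have hsymm : ∀ i j : Fin n, q i * birthDeathMatrix n theta lam mu i j =
      q j * birthDeathMatrix n theta lam mu j i := by
    rintro ⟨i, hi⟩ ⟨j, hj⟩
    simp only [birthDeathMatrix, Matrix.of_apply]
    rcases lt_trichotomy i j with h | rfl | h
    · by_cases h1 : j = i + 1
      · subst h1
        have := hrev i hj
        simp [show i ≠ i + 1 + 1 by omega]
        linarith
      · grind
    · rfl
    · by_cases h1 : i = j + 1
      · subst h1
        have := hrev j hi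
        simp [show j ≠ j + 1 + 1 by omega]
        linarith
      · grind
  ext j
  have h1 := congrFun hP j
  simp only [Matrix.mulVec, dotProduct, Pi.one_apply, mul_one] at h1
  simp only [Matrix.vecMul, dotProduct, hsymm _ j, ← Finset.mul_sum, h1, mul_one]

theorem trace_potentialKernel (lam q : ℕ → ℝ) :
    (Matrix.of (fun i j : Fin n => potentialKernel lam q i j)).trace =
      ∑ k ∈ Finset.range n, ∑ p ∈ Finset.range k,
        q k * (∑ l ∈ Finset.range (p + 1), q l) / (lam p * q p) := by
  simp only [Matrix.trace, Matrix.diag_apply, Matrix.of_apply]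
  rw [Fin.sum_univ_eq_sum_range (fun k => potentialKernel lam q k k) n]
  refine Finset.sum_congr rfl fun k _ => Finset.sum_congr rfl fun p hp => ?_
  rw [Finset.mem_range] at hp
  rw [if_neg (by omega), sub_zero]

theorem trace_potentialKernel_eq_sum_partialSum {q : ℕ → ℝ}
    (hq1 : ∑ l ∈ Finset.range n, q l = 1) :
    (Matrix.of (fun i j : Fin n => potentialKernel lam q i j)).trace =
      ∑ k ∈ Finset.univ.filter (fun k : Fin n => (k : ℕ) + 1 < n),
        partialSum (fun j : Fin n => q j) k * (1 - partialSum (fun j : Fin n => q j) k) /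
          (lam k * q k) := by
  have hps : ∀ k : Fin n, partialSum (fun j : Fin n => q j) k =
      ∑ l ∈ Finset.range ((k : ℕ) + 1), q l := by
    intro k
    rw [partialSum, Nat.range_succ_eq_Iic, ← Fin.map_valEmbedding_Iic, Finset.sum_map]
    rfl
  simp only [hps]
  rw [Finset.sum_filter, Fin.sum_univ_eq_sum_range (fun k => if k + 1 < n then
    (∑ l ∈ Finset.range (k + 1), q l) * (1 - ∑ l ∈ Finset.range (k + 1), q l) /
      (lam k * q k) else 0) n, ← Finset.sum_filter, trace_potentialKernel,
    Finset.sum_comm' (t' := (Finset.range n).filter (· + 1 < n))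
      (s' := fun p => Finset.Ico (p + 1) n)
      (by intro x y; simp only [Finset.mem_range, Finset.mem_filter, Finset.mem_Ico]; omega)]
  refine Finset.sum_congr rfl fun p hp => ?_
  have hpn : p + 1 ≤ n := (Finset.mem_filter.1 hp).2.le
  -- For fixed `p`, the mass above `p` is `1 - σ p`.
  rw [← Finset.sum_div, ← Finset.sum_mul, ← hq1, ← Finset.sum_range_add_sum_Ico q hpn]
  ring

theorem treeWeight_pos (hlam : ∀ k, k + 1 < n → 0 < lam k)
    (hmu : ∀ k, 1 ≤ k → k < n → 0 < mu k) {k : ℕ} (hk : k < n) :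
    0 < treeWeight n lam mu k := by
  refine mul_pos (Finset.prod_pos fun l hl => hlam l ?_) (Finset.prod_pos fun l hl => hmu l ?_ ?_)
  all_goals rw [Finset.mem_Ico] at hl; omega

theorem lam_mul_treeWeight {k : ℕ} (hk : k + 1 < n) :
    lam k * treeWeight n lam mu k = mu (k + 1) * treeWeight n lam mu (k + 1) := by
  rw [treeWeight, treeWeight, Finset.prod_Ico_succ_top (Nat.zero_le k),
    Finset.prod_eq_prod_Ico_succ_bot hk]
  ring

/-- Splitting the `lam` product of `t k` and the `mu` product of `t j` at `p` frees the factors of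
`lam p * t p`. -/
theorem treeWeight_mul_treeWeight {j k p : ℕ} (hjp : j ≤ p) (hpk : p < k) (hk : k < n) :
    treeWeight n lam mu j * treeWeight n lam mu k =
      forestWeight n lam mu j k p * (lam p * treeWeight n lam mu p) := by
  have h1 : ∏ l ∈ Finset.Ico 0 k, lam l =
      (∏ l ∈ Finset.Ico 0 p, lam l) * lam p * ∏ l ∈ Finset.Ico (p + 1) k, lam l := by
    rw [← Finset.prod_Ico_succ_top (Nat.zero_le p), Finset.prod_Ico_consecutive _ (by omega) hpk]
  have h2 : ∏ l ∈ Finset.Ico (j + 1) n, mu l =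
      (∏ l ∈ Finset.Icc (j + 1) p, mu l) * ∏ l ∈ Finset.Ico (p + 1) n, mu l := by
    rw [← Finset.Ico_add_one_right_eq_Icc,
      Finset.prod_Ico_consecutive _ (by omega) (by omega)]
  simp only [treeWeight, forestWeight, h1, h2]
  ring

theorem treeWeight_eq_mul_rateRatio (hmu : ∀ k, 1 ≤ k → k < n → 0 < mu k) {j : ℕ} (hj : j < n) :
    treeWeight n lam mu j = treeWeight n lam mu 0 * rateRatio lam mu j := by
  have h2 : ∏ l ∈ Finset.Ico 1 n, mu l =
      (∏ l ∈ Finset.Icc 1 j, mu l) * ∏ l ∈ Finset.Ico (j + 1) n, mu l := by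
    rw [← Finset.Ico_add_one_right_eq_Icc,
      Finset.prod_Ico_consecutive _ (by omega) (by omega)]
  have h3 : ∏ l ∈ Finset.Icc 1 j, mu l ≠ 0 := by
    refine Finset.prod_ne_zero_iff.2 fun l hl => ?_
    rw [Finset.mem_Icc] at hl
    exact (hmu l hl.1 (by omega)).ne'
  rw [treeWeight, treeWeight, rateRatio, zero_add, h2, Finset.Ico_self, Finset.prod_empty]
  field_simp

theorem trace_potentialKernel_eq_sum_forestWeight
    (hlam : ∀ k, k + 1 < n → 0 < lam k) (hmu : ∀ k, 1 ≤ k → k < n → 0 < mu k) {T : ℝ}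
    (hT : T ≠ 0) :
    (Matrix.of (fun i j : Fin n =>
        potentialKernel lam (fun k => treeWeight n lam mu k / T) i j)).trace =
      (∑ k ∈ Finset.range n, ∑ j ∈ Finset.range k, ∑ p ∈ Finset.Ico j k,
        forestWeight n lam mu j k p) / T := by
  rw [trace_potentialKernel, Finset.sum_div]
  refine Finset.sum_congr rfl fun k hk => ?_
  rw [Finset.mem_range] at hk
  rw [Finset.sum_comm' (t' := Finset.range k) (s' := fun p => Finset.range (p + 1))
    (by intro x y; simp only [Finset.mem_range, Finset.mem_Ico]; omega), Finset.sum_div]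
  refine Finset.sum_congr rfl fun p hp => ?_
  rw [Finset.mem_range] at hp
  rw [Finset.mul_sum, Finset.sum_div, Finset.sum_div]
  refine Finset.sum_congr rfl fun j hj => ?_
  rw [Finset.mem_range] at hj
  have h := treeWeight_mul_treeWeight (lam := lam) (mu := mu) (Nat.lt_succ_iff.1 hj) hp hk
  have h1 := (hlam p (by omega)).ne'
  have h2 := (treeWeight_pos hlam hmu (show p < n by omega)).ne'
  -- Two factors `1 / T` above and one below leave a single `1 / T`.
  field_simp
  linear_combination h

end BirthDeath

theorem mainTheorem7 (n : ℕ) (hn : 1 ≤ n) (theta lam mu : ℕ → ℝ)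
    (P : Matrix (Fin n) (Fin n) ℝ) (hP : P = birthDeathMatrix n theta lam mu)
    (hstoch : P ∈ Matrix.rowStochastic ℝ (Fin n)) (hirr : P.IsIrreducible) :
    (∀ v : Fin n → ℝ, ∑ i, v i = 1 →
      IsUnit (kemenyMatrix P v) ∧
      kemenyConstant P v =
        (∑ k ∈ Finset.range n, ∑ j ∈ Finset.range k, ∑ p ∈ Finset.Ico j k,
            forestWeight n lam mu j k p) /
          ∑ k ∈ Finset.range n, treeWeight n lam mu k) ∧
    0 < ∑ k ∈ Finset.range n, treeWeight n lam mu k ∧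
    (∃! pi : Fin n → ℝ, IsStationaryVector P pi) ∧
    (∀ pi : Fin n → ℝ, IsStationaryVector P pi →
      (∀ i, 0 < pi i) ∧
      (∀ v : Fin n → ℝ, ∑ i, v i = 1 →
        kemenyConstant P v =
          ∑ k ∈ Finset.univ.filter (fun k : Fin n => (k : ℕ) + 1 < n),
            partialSum pi k * (1 - partialSum pi k) / (lam k * pi k)) ∧
      pi ⟨0, hn⟩ = (∑ j ∈ Finset.range n, rateRatio lam mu j)⁻¹ ∧
      (∀ j : Fin n, 1 ≤ (j : ℕ) → pi j = pi ⟨0, hn⟩ * rateRatio lam mu j)) := by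
  subst hP
  have hlam : ∀ k, k + 1 < n → 0 < lam k := fun k hk => lam_pos_of_isIrreducible hirr hk
  have hmu : ∀ k, 1 ≤ k → k < n → 0 < mu k := fun k h1 hk => mu_pos_of_isIrreducible hirr h1 hk
  have hP1 : birthDeathMatrix n theta lam mu *ᵥ 1 = 1 := hstoch.2
  have hT : 0 < ∑ k ∈ Finset.range n, treeWeight n lam mu k :=
    Finset.sum_pos (fun k hk => treeWeight_pos hlam hmu (Finset.mem_range.1 hk))
      ⟨0, Finset.mem_range.2 hn⟩
  set T := ∑ k ∈ Finset.range n, treeWeight n lam mu k with hTdef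
  set q : ℕ → ℝ := fun k => treeWeight n lam mu k / T with hqdef
  have hq : ∀ k, k < n → 0 < q k := fun k hk => div_pos (treeWeight_pos hlam hmu hk) hT
  have hq1 : ∑ l ∈ Finset.range n, q l = 1 := by
    rw [← Finset.sum_div, div_self hT.ne']
  have hq1' : ∑ i : Fin n, q i = 1 := by rw [Fin.sum_univ_eq_sum_range q n, hq1]
  have hrev : ∀ k, k + 1 < n → lam k * q k = mu (k + 1) * q (k + 1) := fun k hk => by
    simp only [hqdef, ← mul_div_assoc, lam_mul_treeWeight hk]
  have hG := one_sub_birthDeathMatrix_mul_potentialKernel hP1 hlam hq hq1 hrev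
  have hG1 : Matrix.of (fun i j : Fin n => potentialKernel lam q i j) *ᵥ 1 = 0 := by
    ext i
    simp only [Matrix.mulVec, dotProduct, Matrix.of_apply, Pi.one_apply, mul_one, Pi.zero_apply]
    rw [Fin.sum_univ_eq_sum_range (fun j => potentialKernel lam q i j) n,
      sum_potentialKernel hq1 i.2]
  have hκ : ∀ v : Fin n → ℝ, ∑ i, v i = 1 → kemenyConstant (birthDeathMatrix n theta lam mu) v =
      (Matrix.of (fun i j : Fin n => potentialKernel lam q i j)).trace :=
    fun v hv => kemenyConstant_eq_trace hP1 hG hG1 hq1' hv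
  have hstat : IsStationaryVector (birthDeathMatrix n theta lam mu) (fun j : Fin n => q j) :=
    ⟨vecMul_birthDeathMatrix_of_reversible hP1 hrev, hq1'⟩
  refine ⟨fun v hv => ⟨isUnit_kemenyMatrix hP1 hG hv, ?_⟩, hT,
    ⟨_, hstat, fun x hx => hx.eq hG⟩, fun x hx => ?_⟩
  · rw [hκ v hv, trace_potentialKernel_eq_sum_forestWeight hlam hmu hT.ne']
  · rw [hx.eq hG]
    have hT0 : T = treeWeight n lam mu 0 * ∑ j ∈ Finset.range n, rateRatio lam mu j := by
      rw [hTdef, Finset.mul_sum]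
      exact Finset.sum_congr rfl fun j hj =>
        treeWeight_eq_mul_rateRatio hmu (Finset.mem_range.1 hj)
    have ht0 := (treeWeight_pos hlam hmu (show 0 < n from hn)).ne'
    refine ⟨fun i => hq i i.2, fun v hv => ?_, ?_, fun j _ => ?_⟩
    · rw [hκ v hv, trace_potentialKernel_eq_sum_partialSum hq1]
    · simp only [hqdef]
      rw [hT0, div_mul_cancel_left₀ ht0]
    · simp only [hqdef]
      rw [treeWeight_eq_mul_rateRatio hmu j.2, mul_div_right_comm]
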